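/- Let $n\ge 1$, $d=2^n$, and let $U,V$ be unitary operators on $n$ qubits. Let $\lambda^{\rm exact}_1,\dots,\lambda^{\rm exact}_d$ and $\lambda_1,\dots,\lambda_d$ be the energies of $U$ and $V$, i.e. real numbers such that the eigenvalues of $U$ and of $V$, with multiplicity, are $e^{-i\lambda^{\rm exact}_1},\dots,e^{-i\lambda^{\rm exact}_d}$ and $e^{-i\lambda_1},\dots,e^{-i\lambda_d}$ respectively. Let $\|X\|_2=\sqrt{\mathrm{Tr}(X^\dagger X)}$, let $$C_{HST}(U,V)=1-\frac{1}{d^2}|\mathrm{Tr}(UV^\dagger)|^2,\qquad C_{LHST}(U,V)=1-\frac1n\sum_{j=1}^n F_e^{(j)},$$ where $F_e^{(j)}=\mathrm{Tr}\big(|\Phi^+\rangle\langle\Phi^+|\,(\mathcal E_j\otimes\mathcal I)(|\Phi^+\rangle\langle\Phi^+|)\big)$, $|\Phi^+\rangle=(|00\rangle+|11\rangle)/\sqrt2$, and $\mathcal E_j$ is the one-qubit channel $\mathcal E_j(\rho)=\mathrm{Tr}_{\overline{j}}\big(UV^\dagger(\rho_j\otimes \mathbb 1_{\overline j}/2^{n-1})VU^\dagger\big)$,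 with $\overline j$ the set of all qubits except the $j$-th. For a permutation $\sigma$ of $\{1,\dots,d\}$ and $\phi\in\mathbb R$ put $$S_\sigma(\phi)=\sum_{i=1}^d 2\big(1-\cos(\lambda_i^{\rm exact}-\lambda_{\sigma(i)}+\phi)\big).$$ Then: 1. There is a permutation $\sigma$ with $\sum_i|e^{i\lambda^{\rm exact}_i}-e^{i\lambda_{\sigma(i)}}|^2\le\|U-V\|_2^2$. 2. The minimum of $\phi\mapsto\|U-e^{i\phi}V\|_2$ over $\phi\in\mathbb R$ is attained. For every $\phi_0$ that attains it, $\|U-e^{i\phi_0}V\|_2=\sqrt{2d\big(1-\sqrt{1-C_{HST}(U,V)}\big)}$, and there is a permutation $\sigma$ (which may depend on $\phi_0$ and differ from the one in 1) such that $S_\sigma(\phi_0)\le\|U-e^{i\phi_0}V\|_2^2$ and, if $n\,C_{LHST}(U,V)\le1$, also $$S_\sigma(\phi_0)\le B:=2d\Big(1-\sqrt{1-n\,C_{LHST}(U,V)}\Big);$$ in particular $S_\sigma(\phi_0)\le\sqrt{B}$ when moreover $B\le1$. 3. For every $\varepsilon>0$ there is $\delta>0$, depending only on $n$ and $\varepsilon$,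 such that for all $U,V$, $\lambda^{\rm exact}$, $\lambda$ as above with $C_{LHST}(U,V)<\delta$ and every minimizing $\phi_0$ there is a permutation $\sigma$ with $S_\sigma(\phi_0)\le B$, $S_\sigma(\phi_0)<\varepsilon$, and, for every $i$, $|\lambda_i^{\rm exact}-\lambda_{\sigma(i)}+\phi_0-2\pi k|<\varepsilon$ for some integer $k$. -/

import Mathlib

open scoped Matrix Kronecker Matrix.Norms.Frobenius

noncomputable section

namespace VFF

/-- Labels of the computational basis of `n` qubits (dimension `d = 2 ^ n`). -/
abbrev Qubits (n : ℕ) : Type := Fin n → Fin 2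

/-- Labels of the computational basis of all qubits except the `j`-th. -/
abbrev Rest (n : ℕ) (j : Fin n) : Type := {k : Fin n // k ≠ j} → Fin 2

/-- The identification `ℋ ≅ ℋ_j ⊗ ℋ_{j̄}` that singles out qubit `j`, on basis labels. -/
def split {n : ℕ} (j : Fin n) : Qubits n ≃ Fin 2 × Rest n j :=
  Equiv.funSplitAt j (Fin 2)

/-- The partial trace over the second tensor factor. -/
def partialTrace {α β : Type*} [Fintype β] :
    Matrix (α × β) (α × β) ℂ →ₗ[ℂ] Matrix α α ℂ where
  toFun M := Matrix.of fun a b => ∑ z, M (a, z) (b, z)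
  map_add' M N := by
    ext a b
    simp [Finset.sum_add_distrib]
  map_smul' c M := by
    ext a b
    simp [Finset.mul_sum]

/-- The operator `ρ_j ⊗ 𝟙_{j̄} / 2 ^ (n - 1)` on `n` qubits, where `ρ` is placed on qubit `j`. -/
def mixedExtension {n : ℕ} (j : Fin n) :
    Matrix (Fin 2) (Fin 2) ℂ →ₗ[ℂ] Matrix (Qubits n) (Qubits n) ℂ where
  toFun ρ := (ρ ⊗ₖ (((2 : ℂ) ^ (n - 1))⁻¹ • (1 : Matrix (Rest n j) (Rest n j) ℂ))).submatrix
    (split j) (split j)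
  map_add' ρ τ := by
    ext x y
    simp [add_mul]
  map_smul' c ρ := by
    ext x y
    simp [mul_assoc]

/-- The one-qubit channel
`ℰ_j(ρ) = Tr_{j̄} (U V† (ρ_j ⊗ 𝟙_{j̄} / 2 ^ (n - 1)) V U†)`. -/
def localChannel {n : ℕ} (U V : Matrix (Qubits n) (Qubits n) ℂ) (j : Fin n) :
    Matrix (Fin 2) (Fin 2) ℂ →ₗ[ℂ] Matrix (Fin 2) (Fin 2) ℂ where
  toFun ρ := partialTrace
    ((U * Vᴴ * mixedExtension j ρ * V * Uᴴ).submatrix (split j).symm (split j).symm)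
  map_add' ρ τ := by
    rw [map_add, mul_add, add_mul, add_mul, Matrix.submatrix_add, ← map_add]
    rfl
  map_smul' c ρ := by
    rw [map_smul, Matrix.mul_smul, Matrix.smul_mul, Matrix.smul_mul, Matrix.submatrix_smul,
      RingHom.id_apply, ← map_smul]
    rfl

/-- `ℰ ⊗ ℐ_B` applied to an operator on `A ⊗ B`: `ℰ` acts on each block with fixed `B`-labels. -/
def tensorId {α β : Type*} (E : Matrix α α ℂ →ₗ[ℂ] Matrix α α ℂ)
    (X : Matrix (α × β) (α × β) ℂ) : Matrix (α × β) (α × β) ℂ :=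
  Matrix.of fun p q => E (Matrix.of fun a b => X (a, p.2) (b, q.2)) p.1 q.1

/-- The two-qubit Bell state `|Φ⁺⟩ = (|00⟩ + |11⟩) / √2`. -/
def bell : Fin 2 × Fin 2 → ℂ := fun p => if p.1 = p.2 then ((√2 : ℝ) : ℂ)⁻¹ else 0

/-- The projector `|Φ⁺⟩⟨Φ⁺|`. -/
def bellProj : Matrix (Fin 2 × Fin 2) (Fin 2 × Fin 2) ℂ := Matrix.vecMulVec bell (star bell)

/-- The entanglement fidelity
`F_e^{(j)} = Tr (|Φ⁺⟩⟨Φ⁺| (ℰ_j ⊗ ℐ)(|Φ⁺⟩⟨Φ⁺|))` (the trace is a real number). -/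
def entanglementFidelity {n : ℕ} (U V : Matrix (Qubits n) (Qubits n) ℂ) (j : Fin n) : ℝ :=
  (bellProj * tensorId (localChannel U V j) bellProj).trace.re

/-- The local Hilbert-Schmidt test cost `C_LHST(U, V) = 1 - (1 / n) ∑_j F_e^{(j)}`. -/
def costLHST {n : ℕ} (U V : Matrix (Qubits n) (Qubits n) ℂ) : ℝ :=
  1 - (1 / (n : ℝ)) * ∑ j : Fin n, entanglementFidelity U V j

/-- The Hilbert-Schmidt test cost `C_HST(U, V) = 1 - |Tr (U V†)|² / d²` with `d = 2 ^ n`. -/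
def costHST {n : ℕ} (U V : Matrix (Qubits n) (Qubits n) ℂ) : ℝ :=
  1 - (1 / ((2 : ℝ) ^ n) ^ 2) * ‖(U * Vᴴ).trace‖ ^ 2

/-- `E` lists the energies of the evolution `U = e^{-iH}`: the eigenvalues of `U`, with
multiplicity, are the numbers `e^{-i E_k}`. -/
def IsEnergies {n : ℕ} (U : Matrix (Qubits n) (Qubits n) ℂ) (E : Fin (2 ^ n) → ℝ) : Prop :=
  U.charpoly.roots = Finset.univ.val.map fun k => Complex.exp (-((E k : ℂ) * Complex.I))

/-- `φ` is an optimal global phase: it minimizes `‖U - e^{iφ} V‖₂` (Hilbert-Schmidt norm). -/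
def IsOptimalPhase {n : ℕ} (U V : Matrix (Qubits n) (Qubits n) ℂ) (φ : ℝ) : Prop :=
  ∀ ψ : ℝ, ‖U - Complex.exp ((φ : ℂ) * Complex.I) • V‖ ≤
    ‖U - Complex.exp ((ψ : ℂ) * Complex.I) • V‖

/-- The total spectral discrepancy
`∑ᵢ 2 (1 - cos (λᵢ^exact - λ_{σ(i)} + φ))` for the matching `σ` and the global phase `φ`. -/
def discrepancy {d : ℕ} (lamExact lam : Fin d → ℝ) (σ : Equiv.Perm (Fin d)) (φ : ℝ) : ℝ :=
  ∑ i, 2 * (1 - Real.cos (lamExact i - lam (σ i) + φ))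

/-- The bound `2d (1 - √(1 - n C_LHST(U, V)))` with `d = 2 ^ n`. -/
def costBound {n : ℕ} (U V : Matrix (Qubits n) (Qubits n) ℂ) : ℝ :=
  2 * (2 : ℝ) ^ n * (1 - √(1 - (n : ℝ) * costLHST U V))

end VFF

end

/-! Spectral side: let `W` be the unitary between eigenbases of `U` and `V`. Then ‖U - V‖² = ∑ |W i
j|² |μ i - ν j|², and |W i j|² is doubly stochastic, so Birkhoff's theorem yields a permutation
doing no worse (Hoffman–Wielandt). Applied to `U` and e^{iφ}V, whose eigenvalues are e^{i(φ - λ)},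
this bounds the discrepancy by ‖U - e^{iφ}V‖² for every φ.

Phase: ‖U - e^{iφ}V‖² = 2d - 2 Re(e^{-iφ} Tr UV†), with minimum 2d - 2|Tr UV†|, which is the
expression in C_HST.

Local cost: F_e^{(j)} = ‖P_j(UV†)‖²/d, where P_j (`siteProj`) projects orthogonally onto operators
trivial on qubit j. The P_j commute and their product projects onto scalars, leaving norm² |Tr
UV†|²/d. A union bound for commuting projections gives C_HST ≤ n C_LHST (`costHST_le`).

Smallness: 1 - √(1 - x) ≤ x on [0, 1] makes the bound linear in the cost, and 1 - cos θ ≥ 2θ²/π² on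
[-π, π] turns a small discrepancy into close energies. -/

/-- Two functions with the same multiset of values differ by a bijection of their domains. -/
theorem exists_equiv_of_map_univ_eq {α β γ : Type*} [Fintype α] [Fintype β] {f : α → γ} {g : β → γ}
    (h : Finset.univ.val.map f = Finset.univ.val.map g) : ∃ e : α ≃ β, ∀ a, g (e a) = f a := by
  classical
  have key (c : γ) : Nonempty ({a // f a = c} ≃ {b // g b = c}) := by
    rw [← Fintype.card_eq, Fintype.card_subtype, Fintype.card_subtype]
    have := congrArg (Multiset.count c) h
    rw [Multiset.count_map, Multiset.count_map] at this
    simp only [eq_comm (a := c)] at this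
    exact this
  exact ⟨Equiv.ofFiberEquiv fun c => (key c).some, fun a => Equiv.ofFiberEquiv_map _ a⟩

/-! ### Spectral theorem for unitary operators -/

section UnitaryOperator

open Module.End ContinuousLinearMap

variable {E : Type*} [NormedAddCommGroup E] [InnerProductSpace ℂ E] [FiniteDimensional ℂ E]

/-- The eigenspaces of a unitary operator are mutually orthogonal. -/
theorem orthogonalFamily_eigenspace_of_mem_unitary {T : E →L[ℂ] E}
    (hT : T ∈ unitary (E →L[ℂ] E)) :
    OrthogonalFamily ℂ (fun μ => eigenspace (T : E →ₗ[ℂ] E) μ)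
      fun μ => (eigenspace (T : E →ₗ[ℂ] E) μ).subtypeₗᵢ := by
  rintro μ ν hμν ⟨v, hv⟩ ⟨w, hw⟩
  rw [mem_eigenspace_iff, coe_coe] at hv hw
  change inner ℂ v w = 0
  by_contra hne
  -- If ⟨v, w⟩ ≠ 0, preservation of inner products forces conj μ · ν = 1 = conj μ · μ, hence μ = ν.
  have h := inner_map_map_of_mem_unitary hT v w
  rw [hv, hw, inner_smul_left, inner_smul_right, ← mul_assoc, mul_eq_right₀ hne] at h
  have hv0 : v ≠ 0 := by rintro rfl; simp at hne
  have h' := inner_map_map_of_mem_unitary hT v v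
  rw [hv, inner_smul_left, inner_smul_right, ← mul_assoc,
    mul_eq_right₀ (inner_self_ne_zero.2 hv0)] at h'
  have hμ : (starRingEnd ℂ) μ ≠ 0 := left_ne_zero_of_mul_eq_one h'
  exact hμν (mul_left_cancel₀ hμ (h'.trans h.symm))

/-- The eigenspaces of a normal operator on a finite-dimensional space span the space. -/
theorem iSup_eigenspace_eq_top_of_isStarNormal (T : E →L[ℂ] E) [IsStarNormal T] :
    ⨆ μ, eigenspace (T : E →ₗ[ℂ] E) μ = ⊤ := by
  -- The real and imaginary parts are commuting self-adjoint operators; a joint eigenvector for (α,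
  -- β) is an eigenvector of `T` for α + iβ.
  have hA : ((realPart T : E →L[ℂ] E) : E →ₗ[ℂ] E).IsSymmetric :=
    (realPart T).2.isSymmetric
  have hB : ((imaginaryPart T : E →L[ℂ] E) : E →ₗ[ℂ] E).IsSymmetric :=
    (imaginaryPart T).2.isSymmetric
  have hAB : Commute ((realPart T : E →L[ℂ] E) : E →ₗ[ℂ] E)
      ((imaginaryPart T : E →L[ℂ] E) : E →ₗ[ℂ] E) :=
    congrArg (fun S : E →L[ℂ] E => (S : E →ₗ[ℂ] E)) (Commute.realPart_imaginaryPart T).eq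
  rw [eq_top_iff, ← hA.iSup_iSup_eigenspace_inf_eigenspace_eq_top_of_commute hB hAB]
  refine iSup_le fun α => iSup_le fun β => le_trans ?_ (le_iSup _ (α + Complex.I * β))
  rintro v ⟨hvA, hvB⟩
  rw [SetLike.mem_coe, mem_eigenspace_iff, coe_coe] at hvA hvB
  rw [mem_eigenspace_iff, coe_coe]
  conv_lhs => rw [← realPart_add_I_smul_imaginaryPart T]
  rw [add_apply, smul_apply, hvA, hvB, smul_smul, add_smul]

/-- A unitary operator on a finite-dimensional space has an orthonormal eigenbasis. -/
theorem exists_orthonormalBasis_eigenvectors_of_mem_unitary {ι : Type*} [Fintype ι]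
    {T : E →L[ℂ] E} (hT : T ∈ unitary (E →L[ℂ] E)) (hι : Module.finrank ℂ E = Fintype.card ι) :
    ∃ (b : OrthonormalBasis ι ℂ E) (μ : ι → ℂ), ∀ i, T (b i) = μ i • b i := by
  classical
  have hfam : OrthogonalFamily ℂ (fun μ : Eigenvalues (T : E →ₗ[ℂ] E) =>
      eigenspace (T : E →ₗ[ℂ] E) μ) fun μ => (eigenspace (T : E →ₗ[ℂ] E) μ).subtypeₗᵢ :=
    (orthogonalFamily_eigenspace_of_mem_unitary hT).comp Subtype.coe_injective
  have htop : (⨆ μ : Eigenvalues (T : E →ₗ[ℂ] E), eigenspace (T : E →ₗ[ℂ] E) μ)ᗮ = ⊥ := by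
    change (⨆ μ : {μ // eigenspace (T : E →ₗ[ℂ] E) μ ≠ ⊥}, eigenspace (T : E →ₗ[ℂ] E) μ)ᗮ = ⊥
    have : IsStarNormal T := ⟨by
      rw [commute_iff_eq, Unitary.star_mul_self_of_mem hT, Unitary.mul_star_self_of_mem hT]⟩
    rw [iSup_ne_bot_subtype, iSup_eigenspace_eq_top_of_isStarNormal, Submodule.top_orthogonal_eq_bot]
  have hint := hfam.isInternal_iff.2 htop
  let e : Fin (Fintype.card ι) ≃ ι := (Fintype.equivFin ι).symm
  refine ⟨(hint.subordinateOrthonormalBasis hι hfam).reindex e,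
    fun i => ((hint.subordinateOrthonormalBasisIndex hι (e.symm i) hfam :
      Eigenvalues (T : E →ₗ[ℂ] E)) : ℂ), fun i => ?_⟩
  rw [OrthonormalBasis.reindex_apply]
  exact mem_eigenspace_iff.1 (hint.subordinateOrthonormalBasis_subordinate hι (e.symm i) hfam)

end UnitaryOperator

/-- Unitary matrices are unitarily diagonalizable. -/
theorem Matrix.exists_mul_diagonal_of_mem_unitaryGroup {ι : Type*} [Fintype ι] [DecidableEq ι]
    {U : Matrix ι ι ℂ} (hU : U ∈ unitaryGroup ι ℂ) :
    ∃ P ∈ unitaryGroup ι ℂ, ∃ μ : ι → ℂ, U * P = P * diagonal μ := by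
  have hT : toEuclideanCLM (n := ι) (𝕜 := ℂ) U ∈ unitary _ :=
    Unitary.map_mem (toEuclideanCLM (n := ι) (𝕜 := ℂ)) hU
  obtain ⟨b, μ, hb⟩ := exists_orthonormalBasis_eigenvectors_of_mem_unitary (ι := ι) hT (by simp)
  refine ⟨of fun i j => b j i, ?_, μ, ?_⟩
  · convert OrthonormalBasis.toMatrix_orthonormalBasis_mem_unitary (EuclideanSpace.basisFun ι ℂ) b
      using 1
    ext i j
    simp [Module.Basis.toMatrix_apply]
  · ext i j
    have := congrArg (fun v => v.ofLp i) (hb j)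
    rw [mul_diagonal]
    simpa [mul_comm, mul_apply, mulVec, dotProduct] using this

/-- `U` equals P D P*, and cyclicity of the characteristic polynomial brings P* next to P. -/
theorem Matrix.roots_charpoly_of_mul_eq_mul_diagonal {ι : Type*} [Fintype ι] [DecidableEq ι]
    {U P : Matrix ι ι ℂ} {μ : ι → ℂ} (hP : P ∈ unitaryGroup ι ℂ) (h : U * P = P * diagonal μ) :
    U.charpoly.roots = Finset.univ.val.map μ := by
  have hU : U = P * (diagonal μ * star P) := by
    rw [← mul_assoc, ← h, mul_assoc, mem_unitaryGroup_iff.1 hP, mul_one]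
  rw [hU, charpoly_mul_comm, mul_assoc, mem_unitaryGroup_iff'.1 hP, mul_one, charpoly_diagonal,
    Polynomial.roots_prod _ _ (Finset.prod_ne_zero_iff.2 fun i _ => Polynomial.X_sub_C_ne_zero _)]
  simp [Multiset.bind_singleton]

/-- A linear functional on doubly stochastic matrices is bounded below by its value at some
permutation matrix. -/
theorem exists_perm_sum_le_of_mem_doublyStochastic {ι : Type*} [Fintype ι] [DecidableEq ι]
    {M : Matrix ι ι ℝ} (hM : M ∈ doublyStochastic ℝ ι) (c : ι → ι → ℝ) :
    ∃ σ : Equiv.Perm ι, ∑ i, c i (σ i) ≤ ∑ i, ∑ j, M i j * c i j := by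
  obtain ⟨w, hw0, hw1, hwM⟩ := exists_eq_sum_perm_of_mem_doublyStochastic hM
  have hsum : ∑ i, ∑ j, M i j * c i j = ∑ σ, w σ * ∑ i, c i (σ i) := by
    have hrow (i : ι) : ∑ j, M i j * c i j = ∑ σ, w σ * c i (σ i) := by
      simp_rw [← hwM, Matrix.sum_apply, Finset.sum_mul]
      rw [Finset.sum_comm]
      refine Finset.sum_congr rfl fun σ _ => ?_
      simp [Equiv.Perm.permMatrix, PEquiv.toMatrix_apply]
    simp_rw [hrow, Finset.mul_sum]
    exact Finset.sum_comm
  -- If every permutation exceeded the average, so would their convex combination; some weight is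
  -- positive, so the inequality is strict.
  by_contra! hlt
  have : ∑ σ, w σ * ∑ i, ∑ j, M i j * c i j < ∑ σ, w σ * ∑ i, c i (σ i) := by
    obtain ⟨σ, -, hσ⟩ : ∃ σ ∈ Finset.univ, 0 < w σ := by
      by_contra! hle
      linarith [Finset.sum_nonpos hle]
    exact Finset.sum_lt_sum (fun τ _ => mul_le_mul_of_nonneg_left (hlt τ).le (hw0 τ))
      ⟨σ, Finset.mem_univ _, mul_lt_mul_of_pos_left (hlt σ) hσ⟩
  rw [← Finset.sum_mul, hw1, one_mul, hsum] at this
  exact lt_irrefl _ this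

/-! ### Frobenius norm and the Hoffman–Wielandt inequality -/

namespace Matrix

variable {ι : Type*} [Fintype ι] [DecidableEq ι]

theorem frobenius_norm_sq {m n : Type*} [Fintype m] [Fintype n] (A : Matrix m n ℂ) :
    ‖A‖ ^ 2 = ∑ i, ∑ j, ‖A i j‖ ^ 2 := by
  rw [frobenius_norm_def, ← Real.sqrt_eq_rpow, Real.sq_sqrt]
  · simp
  · positivity

theorem frobenius_norm_sq_eq_trace {m n : Type*} [Fintype m] [Fintype n] (A : Matrix m n ℂ) :
    ((‖A‖ ^ 2 : ℝ) : ℂ) = (A * Aᴴ).trace := by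
  simp_rw [frobenius_norm_sq, trace, diag, mul_apply, conjTranspose_apply, ← starRingEnd_apply,
    Complex.mul_conj']
  push_cast
  rfl

theorem frobenius_norm_mul_of_mem_unitaryGroup (A : Matrix ι ι ℂ) {Q : Matrix ι ι ℂ}
    (hQ : Q ∈ unitaryGroup ι ℂ) : ‖A * Q‖ = ‖A‖ := by
  refine (sq_eq_sq₀ (norm_nonneg _) (norm_nonneg _)).1 (Complex.ofReal_injective ?_)
  rw [frobenius_norm_sq_eq_trace, frobenius_norm_sq_eq_trace, conjTranspose_mul, mul_assoc,
    ← mul_assoc Q, ← star_eq_conjTranspose Q, mem_unitaryGroup_iff.1 hQ, one_mul]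

theorem frobenius_norm_mul_of_mem_unitaryGroup' (A : Matrix ι ι ℂ) {P : Matrix ι ι ℂ}
    (hP : P ∈ unitaryGroup ι ℂ) : ‖P * A‖ = ‖A‖ := by
  rw [← frobenius_norm_conjTranspose, conjTranspose_mul, ← star_eq_conjTranspose P,
    frobenius_norm_mul_of_mem_unitaryGroup _ (Unitary.star_mem hP), frobenius_norm_conjTranspose]

theorem frobenius_norm_sq_of_mem_unitaryGroup {U : Matrix ι ι ℂ} (hU : U ∈ unitaryGroup ι ℂ) :
    ‖U‖ ^ 2 = Fintype.card ι := by
  refine Complex.ofReal_injective ?_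
  rw [frobenius_norm_sq_eq_trace, ← star_eq_conjTranspose, mem_unitaryGroup_iff.1 hU, trace_one,
    Complex.ofReal_natCast]

/-- Rows and columns of a unitary matrix are unit vectors. -/
theorem normSq_mem_doublyStochastic {W : Matrix ι ι ℂ} (hW : W ∈ unitaryGroup ι ℂ) :
    of (fun i j => ‖W i j‖ ^ 2) ∈ doublyStochastic ℝ ι := by
  rw [mem_doublyStochastic_iff_sum]
  refine ⟨fun i j => sq_nonneg _, fun i => Complex.ofReal_injective ?_,
    fun j => Complex.ofReal_injective ?_⟩
  · have h := congrFun (congrFun (mem_unitaryGroup_iff.1 hW) i) i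
    simp only [mul_apply, star_apply, ← starRingEnd_apply, Complex.mul_conj', one_apply_eq] at h
    simpa using h
  · have h := congrFun (congrFun (mem_unitaryGroup_iff'.1 hW) j) j
    simp only [mul_apply, star_apply, ← starRingEnd_apply, Complex.conj_mul', one_apply_eq] at h
    simpa using h

/-- **Hoffman–Wielandt inequality** for unitarily diagonalized matrices. -/
theorem exists_perm_sum_norm_sub_sq_le {A B P Q : Matrix ι ι ℂ} {μ ν : ι → ℂ}
    (hP : P ∈ unitaryGroup ι ℂ) (hQ : Q ∈ unitaryGroup ι ℂ)
    (hA : A * P = P * diagonal μ) (hB : B * Q = Q * diagonal ν) :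
    ∃ σ : Equiv.Perm ι, ∑ i, ‖μ i - ν (σ i)‖ ^ 2 ≤ ‖A - B‖ ^ 2 := by
  have hW : star P * Q ∈ unitaryGroup ι ℂ := mul_mem (Unitary.star_mem hP) hQ
  have hA' : star P * A = diagonal μ * star P := by
    calc star P * A = star P * (A * P) * star P := by
          rw [mul_assoc, mul_assoc, mem_unitaryGroup_iff.1 hP, mul_one]
      _ = _ := by rw [hA, ← mul_assoc, mem_unitaryGroup_iff'.1 hP, one_mul]
  -- With W = P*Q, the (i, j) entry is W i j (μ i - ν j), so the norm is exactly a doubly stochastic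
  -- average.
  have hAB : star P * (A - B) * Q = diagonal μ * (star P * Q) - star P * Q * diagonal ν := by
    rw [mul_sub, sub_mul, hA', mul_assoc, mul_assoc _ B, hB, mul_assoc]
  obtain ⟨σ, hσ⟩ := exists_perm_sum_le_of_mem_doublyStochastic (normSq_mem_doublyStochastic hW)
    fun i j => ‖μ i - ν j‖ ^ 2
  refine ⟨σ, hσ.trans_eq ?_⟩
  rw [← frobenius_norm_mul_of_mem_unitaryGroup' (A - B) (Unitary.star_mem hP),
    ← frobenius_norm_mul_of_mem_unitaryGroup _ hQ, hAB, frobenius_norm_sq]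
  refine Finset.sum_congr rfl fun i _ => Finset.sum_congr rfl fun j _ => ?_
  rw [sub_apply, diagonal_mul, mul_diagonal, of_apply, mul_comm _ (ν j), ← sub_mul, norm_mul,
    mul_pow, mul_comm]

/-- **Hoffman–Wielandt inequality** for unitary matrices, with arbitrary enumerations of the
eigenvalues. -/
theorem exists_perm_sum_norm_sub_sq_le_of_roots {κ : Type*} [Fintype κ]
    {U V : Matrix ι ι ℂ} (hU : U ∈ unitaryGroup ι ℂ) (hV : V ∈ unitaryGroup ι ℂ) {f g : κ → ℂ}
    (hf : U.charpoly.roots = Finset.univ.val.map f)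
    (hg : V.charpoly.roots = Finset.univ.val.map g) :
    ∃ σ : Equiv.Perm κ, ∑ k, ‖f k - g (σ k)‖ ^ 2 ≤ ‖U - V‖ ^ 2 := by
  obtain ⟨P, hP, μ, hμ⟩ := exists_mul_diagonal_of_mem_unitaryGroup hU
  obtain ⟨Q, hQ, ν, hν⟩ := exists_mul_diagonal_of_mem_unitaryGroup hV
  obtain ⟨e, he⟩ := exists_equiv_of_map_univ_eq
    (hf.symm.trans (roots_charpoly_of_mul_eq_mul_diagonal hP hμ))
  obtain ⟨e', he'⟩ := exists_equiv_of_map_univ_eq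
    (hg.symm.trans (roots_charpoly_of_mul_eq_mul_diagonal hQ hν))
  obtain ⟨σ, hσ⟩ := exists_perm_sum_norm_sub_sq_le hP hQ hμ hν
  refine ⟨(e.trans σ).trans e'.symm, le_trans (le_of_eq ?_) hσ⟩
  rw [← e.sum_comp]
  refine Finset.sum_congr rfl fun k _ => ?_
  rw [he, ← he']
  simp

theorem roots_charpoly_smul_of_mem_unitaryGroup {κ : Type*} [Fintype κ]
    {V : Matrix ι ι ℂ} (hV : V ∈ unitaryGroup ι ℂ) {g : κ → ℂ}
    (hg : V.charpoly.roots = Finset.univ.val.map g) (c : ℂ) :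
    (c • V).charpoly.roots = Finset.univ.val.map fun k => c * g k := by
  obtain ⟨Q, hQ, ν, hν⟩ := exists_mul_diagonal_of_mem_unitaryGroup hV
  have h : (c • V) * Q = Q * diagonal (c • ν) := by
    rw [smul_mul, hν, diagonal_smul, Matrix.mul_smul]
  rw [roots_charpoly_of_mul_eq_mul_diagonal hQ h]
  have := congrArg (Multiset.map (c * ·)) ((roots_charpoly_of_mul_eq_mul_diagonal hQ hν).symm.trans hg)
  simpa using this

theorem smul_mem_unitaryGroup {V : Matrix ι ι ℂ} (hV : V ∈ unitaryGroup ι ℂ) {c : ℂ}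
    (hc : ‖c‖ = 1) : c • V ∈ unitaryGroup ι ℂ := by
  rw [mem_unitaryGroup_iff, star_smul, smul_mul_smul_comm, mem_unitaryGroup_iff.1 hV,
    ← starRingEnd_apply, Complex.mul_conj', hc]
  simp

/-- The two cross terms are complex conjugates, so `c` enters only through one real part. -/
theorem frobenius_norm_sub_smul_sq {U V : Matrix ι ι ℂ} (hU : U ∈ unitaryGroup ι ℂ)
    (hV : V ∈ unitaryGroup ι ℂ) {c : ℂ} (hc : ‖c‖ = 1) :
    ‖U - c • V‖ ^ 2 = 2 * Fintype.card ι - 2 * (starRingEnd ℂ c * (U * Vᴴ).trace).re := by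
  have hVU : (V * Uᴴ).trace = starRingEnd ℂ (U * Vᴴ).trace := by
    rw [starRingEnd_apply, ← trace_conjTranspose, conjTranspose_mul, conjTranspose_conjTranspose]
  have h := frobenius_norm_sq_eq_trace (U - c • V)
  rw [conjTranspose_sub, conjTranspose_smul, sub_mul, mul_sub, mul_sub, smul_mul_smul_comm,
    Matrix.mul_smul, Matrix.smul_mul, ← star_eq_conjTranspose U, mem_unitaryGroup_iff.1 hU,
    ← star_eq_conjTranspose V, mem_unitaryGroup_iff.1 hV, star_eq_conjTranspose,
    star_eq_conjTranspose, ← starRingEnd_apply, Complex.mul_conj', hc, trace_sub, trace_sub,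
    trace_sub, trace_smul, trace_smul, trace_smul, hVU, trace_one] at h
  have h' := congrArg Complex.re h
  rw [Complex.ofReal_re] at h'
  rw [h']
  simp
  ring

end Matrix

/-! ### Site projections and the union bound -/

namespace VFF

variable {n : ℕ}

theorem split_symm_apply_self (j : Fin n) (a : Fin 2) (z : Rest n j) :
    (split j).symm (a, z) j = a := by
  simp [split, Equiv.funSplitAt]

theorem update_split_symm (j : Fin n) (a b : Fin 2) (z : Rest n j) :
    Function.update ((split j).symm (a, z)) j b = (split j).symm (b, z) := by
  ext k
  by_cases hk : k = j
  · subst hk; simp [split, Equiv.funSplitAt]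
  · simp [split, Equiv.funSplitAt, hk]

theorem sum_qubits_split {M : Type*} [AddCommMonoid M] (j : Fin n) (f : Qubits n → M) :
    ∑ x, f x = ∑ z, ∑ a, f ((split j).symm (a, z)) := by
  rw [← (split j).symm.sum_comp, Fintype.sum_prod_type_right]

/-- The orthogonal projection of operators on `n` qubits onto those of the form
`𝟙_j ⊗ X`, with `X` acting on the qubits other than the `j`-th. -/
noncomputable def siteProj (j : Fin n) :
    Matrix (Qubits n) (Qubits n) ℂ →ₗ[ℂ] Matrix (Qubits n) (Qubits n) ℂ where
  toFun W := Matrix.of fun x y => if x j = y j then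
    2⁻¹ * ∑ a, W (Function.update x j a) (Function.update y j a) else 0
  map_add' W W' := by
    ext x y
    simp only [Matrix.of_apply, Matrix.add_apply]
    split_ifs <;> simp [Finset.sum_add_distrib, mul_add]
  map_smul' c W := by
    ext x y
    simp only [Matrix.of_apply, Matrix.smul_apply, RingHom.id_apply]
    split_ifs
    · simp only [smul_eq_mul, ← Finset.mul_sum]
      exact mul_left_comm _ _ _
    · simp

theorem siteProj_apply (j : Fin n) (W : Matrix (Qubits n) (Qubits n) ℂ) (x y : Qubits n) :
    siteProj j W x y = if x j = y j then
      2⁻¹ * ∑ a, W (Function.update x j a) (Function.update y j a) else 0 := rfl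

theorem siteProj_split (j : Fin n) (W : Matrix (Qubits n) (Qubits n) ℂ) (a b : Fin 2)
    (z w : Rest n j) :
    siteProj j W ((split j).symm (a, z)) ((split j).symm (b, w)) = if a = b then
      2⁻¹ * ∑ c, W ((split j).symm (c, z)) ((split j).symm (c, w)) else 0 := by
  simp only [siteProj_apply, split_symm_apply_self, update_split_symm]

theorem siteProj_idem (j : Fin n) (W : Matrix (Qubits n) (Qubits n) ℂ) :
    siteProj j (siteProj j W) = siteProj j W := by
  ext x y
  simp only [siteProj_apply, Function.update_self, if_true, Function.update_idem]
  simp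

theorem siteProj_comm (i j : Fin n) (W : Matrix (Qubits n) (Qubits n) ℂ) :
    siteProj i (siteProj j W) = siteProj j (siteProj i W) := by
  obtain rfl | hij := eq_or_ne i j
  · rfl
  ext x y
  simp only [siteProj_apply, Function.update_of_ne hij, Function.update_of_ne hij.symm]
  by_cases hi : x i = y i <;> by_cases hj : x j = y j <;> simp only [hi, hj, if_true, if_false,
    Finset.sum_const_zero, mul_zero]
  congr 1
  rw [← Finset.mul_sum, ← Finset.mul_sum, Finset.sum_comm]
  simp only [Function.update_comm hij]

theorem trace_siteProj (j : Fin n) (W : Matrix (Qubits n) (Qubits n) ℂ) :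
    (siteProj j W).trace = W.trace := by
  simp only [Matrix.trace, Matrix.diag, sum_qubits_split j, siteProj_split, if_true]
  refine Finset.sum_congr rfl fun z _ => ?_
  simp

theorem norm_sq_eq_sum_split (j : Fin n) (W : Matrix (Qubits n) (Qubits n) ℂ) :
    ‖W‖ ^ 2 = ∑ z, ∑ w, ∑ a, ∑ b,
      ‖W ((split j).symm (a, z)) ((split j).symm (b, w))‖ ^ 2 := by
  rw [Matrix.frobenius_norm_sq, sum_qubits_split j]
  refine Finset.sum_congr rfl fun z _ => ?_
  simp only [sum_qubits_split j]
  exact Finset.sum_comm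

/-- Pythagoras, block by block: the off-diagonal entries on qubit j lie wholly in the complement,
and the diagonal pair splits into its mean and the deviations from it. -/
theorem norm_sq_eq_norm_siteProj_sq_add (j : Fin n) (W : Matrix (Qubits n) (Qubits n) ℂ) :
    ‖W‖ ^ 2 = ‖siteProj j W‖ ^ 2 + ‖W - siteProj j W‖ ^ 2 := by
  simp only [norm_sq_eq_sum_split j, ← Finset.sum_add_distrib, Matrix.sub_apply, siteProj_split]
  refine Finset.sum_congr rfl fun z _ => Finset.sum_congr rfl fun w _ => ?_
  simp only [Fin.sum_univ_two, Fin.isValue, if_true, zero_ne_one, one_ne_zero, if_false, sub_zero,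
    norm_zero]
  simp only [← Complex.normSq_eq_norm_sq, Complex.normSq_apply, Complex.sub_re, Complex.sub_im,
    Complex.mul_re, Complex.mul_im, Complex.add_re, Complex.add_im, Complex.inv_re, Complex.inv_im,
    Complex.re_ofNat, Complex.im_ofNat]
  ring

theorem norm_siteProj_sq (j : Fin n) (W : Matrix (Qubits n) (Qubits n) ℂ) :
    ‖siteProj j W‖ ^ 2 = 2⁻¹ * ∑ z, ∑ w,
      ‖∑ c, W ((split j).symm (c, z)) ((split j).symm (c, w))‖ ^ 2 := by
  simp only [norm_sq_eq_sum_split j, siteProj_split]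
  rw [Finset.mul_sum]
  refine Finset.sum_congr rfl fun z _ => ?_
  rw [Finset.mul_sum]
  refine Finset.sum_congr rfl fun w _ => ?_
  simp only [Fin.sum_univ_two, Fin.isValue, if_true, zero_ne_one, one_ne_zero, if_false, norm_zero,
    norm_mul, norm_inv, RCLike.norm_ofNat]
  ring

/-- Invariance at j kills entries whose labels differ at j and makes diagonal entries independent of
coordinate j; changing coordinates one at a time connects all labels. -/
theorem eq_smul_one_of_siteProj_eq {W : Matrix (Qubits n) (Qubits n) ℂ}
    (h : ∀ j, siteProj j W = W) : ∃ c : ℂ, W = c • (1 : Matrix (Qubits n) (Qubits n) ℂ) := by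
  have hupd (x : Qubits n) (j : Fin n) (a : Fin 2) :
      W (Function.update x j a) (Function.update x j a) = W x x := by
    rw [← h j]
    simp [siteProj_apply]
  have hdiag (S : Finset (Fin n)) (x y : Qubits n) : W (S.piecewise x y) (S.piecewise x y) = W y y := by
    induction S using Finset.induction_on with
    | empty => simp
    | insert j S _ ih => rw [Finset.piecewise_insert, hupd, ih]
  refine ⟨W 0 0, ?_⟩
  ext x y
  obtain rfl | hxy := eq_or_ne x y
  · simpa using hdiag Finset.univ x 0
  · obtain ⟨j, hj⟩ := Function.ne_iff.1 hxy
    rw [← h j, siteProj_apply, if_neg hj, Matrix.smul_apply, Matrix.one_apply_ne hxy, smul_zero]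

/-- Union bound for the commuting projections `siteProj j`. -/
theorem exists_joint_siteProj (W : Matrix (Qubits n) (Qubits n) ℂ) (S : Finset (Fin n)) :
    ∃ Q : Matrix (Qubits n) (Qubits n) ℂ →ₗ[ℂ] Matrix (Qubits n) (Qubits n) ℂ,
      (∀ X, ‖Q X‖ ≤ ‖X‖) ∧ (∀ j X, Q (siteProj j X) = siteProj j (Q X)) ∧
      (∀ X, (Q X).trace = X.trace) ∧ (∀ j ∈ S, ∀ X, siteProj j (Q X) = Q X) ∧
      ‖W‖ ^ 2 - ‖Q W‖ ^ 2 ≤ ∑ j ∈ S, (‖W‖ ^ 2 - ‖siteProj j W‖ ^ 2) := by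
  induction S using Finset.induction_on with
  | empty => exact ⟨LinearMap.id, by simp⟩
  | insert i S hi ih =>
    obtain ⟨Q, hnorm, hcomm, htr, hfix, hle⟩ := ih
    refine ⟨siteProj i ∘ₗ Q, fun X => ?_, fun j X => ?_, fun X => ?_, fun j hj X => ?_, ?_⟩
    · refine le_trans ?_ (hnorm X)
      refine (sq_le_sq₀ (norm_nonneg _) (norm_nonneg _)).1 ?_
      rw [LinearMap.comp_apply, norm_sq_eq_norm_siteProj_sq_add i (Q X)]
      exact le_add_of_nonneg_right (sq_nonneg _)
    · simp [hcomm, siteProj_comm i j]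
    · simp [trace_siteProj, htr]
    · rw [LinearMap.comp_apply]
      obtain rfl | hj := Finset.mem_insert.1 hj
      · exact siteProj_idem _ _
      · rw [siteProj_comm, hfix j hj]
    · rw [Finset.sum_insert hi, LinearMap.comp_apply]
      -- The extra loss ‖QW‖² - ‖P_i QW‖² equals ‖Q(W - P_i W)‖² by commutation, and `Q` is a
      -- contraction.
      have h₁ := norm_sq_eq_norm_siteProj_sq_add i (Q W)
      have h₂ := norm_sq_eq_norm_siteProj_sq_add i W
      have h₃ := hnorm (W - siteProj i W)
      rw [map_sub, hcomm] at h₃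
      have h₄ := pow_le_pow_left₀ (norm_nonneg _) h₃ 2
      linarith

/-- Projecting at all sites leaves a scalar matrix with the trace of `W`, whose squared norm is |Tr
W|²/2^n. -/
theorem norm_sq_sub_norm_trace_sq_le (W : Matrix (Qubits n) (Qubits n) ℂ) :
    ‖W‖ ^ 2 - ‖W.trace‖ ^ 2 / 2 ^ n ≤ ∑ j, (‖W‖ ^ 2 - ‖siteProj j W‖ ^ 2) := by
  obtain ⟨Q, -, -, htr, hfix, hle⟩ := exists_joint_siteProj W Finset.univ
  obtain ⟨c, hc⟩ := eq_smul_one_of_siteProj_eq fun j => hfix j (Finset.mem_univ j) W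
  convert hle using 2
  rw [← htr, hc, ← Complex.ofReal_inj, Matrix.frobenius_norm_sq_eq_trace]
  simp only [Matrix.trace_smul, Matrix.trace_one, Matrix.conjTranspose_smul,
    Matrix.mul_smul, Matrix.conjTranspose_one, mul_one, smul_eq_mul, Fintype.card_pi,
    Fintype.card_fin, Finset.prod_const, Finset.card_univ, norm_mul]
  push_cast
  rw [← mul_assoc, ← starRingEnd_apply, Complex.conj_mul', norm_pow, RCLike.norm_ofNat]
  push_cast
  field_simp

/-! ### Entanglement fidelity as a projection norm -/

theorem bellProj_apply (p q : Fin 2 × Fin 2) :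
    bellProj p q = if p.1 = p.2 ∧ q.1 = q.2 then 2⁻¹ else 0 := by
  have h : ((√2 : ℝ) : ℂ)⁻¹ * ((√2 : ℝ) : ℂ)⁻¹ = 2⁻¹ := by
    rw [← mul_inv, ← Complex.ofReal_mul, Real.mul_self_sqrt (by norm_num)]
    norm_num
  simp only [bellProj, Matrix.vecMulVec_apply, Pi.star_apply, bell]
  split_ifs <;> simp_all

/-- The Bell projector is ½ ∑ |s⟩⟨t| ⊗ |s⟩⟨t|, and it occurs twice, whence the factor ¼. -/
theorem trace_bellProj_mul_tensorId (E : Matrix (Fin 2) (Fin 2) ℂ →ₗ[ℂ] Matrix (Fin 2) (Fin 2) ℂ) :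
    (bellProj * tensorId E bellProj).trace =
      4⁻¹ * ∑ s, ∑ t, E (Matrix.single s t 1) s t := by
  have hE (s t : Fin 2) : (Matrix.of fun a b : Fin 2 => bellProj (a, s) (b, t)) =
      (2⁻¹ : ℂ) • Matrix.single s t 1 := by
    ext a b
    simp only [Matrix.of_apply, bellProj_apply, Matrix.smul_apply, Matrix.single_apply, smul_eq_mul,
      eq_comm (a := a), eq_comm (a := b)]
    split_ifs <;> simp
  have hX (p q : Fin 2 × Fin 2) :
      tensorId E bellProj p q = 2⁻¹ * E (Matrix.single p.2 q.2 1) p.1 q.1 := by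
    rw [tensorId, Matrix.of_apply, hE, map_smul, Matrix.smul_apply, smul_eq_mul]
  simp only [Matrix.trace, Matrix.diag, Matrix.mul_apply, hX, bellProj_apply,
    Fintype.sum_prod_type, Fin.sum_univ_two, Fin.isValue, zero_ne_one, one_ne_zero, and_true,
    and_false, if_true, if_false, zero_mul, add_zero, zero_add]
  ring

theorem mixedExtension_split (j : Fin n) (ρ : Matrix (Fin 2) (Fin 2) ℂ) (a b : Fin 2)
    (z w : Rest n j) :
    mixedExtension j ρ ((split j).symm (a, z)) ((split j).symm (b, w)) =
      if z = w then ((2 : ℂ) ^ (n - 1))⁻¹ * ρ a b else 0 := by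
  simp [mixedExtension, Matrix.one_apply, mul_comm]

theorem localChannel_single (U V : Matrix (Qubits n) (Qubits n) ℂ) (j : Fin n) (s t : Fin 2) :
    localChannel U V j (Matrix.single s t 1) s t = ((2 : ℂ) ^ (n - 1))⁻¹ * ∑ z, ∑ w,
      (U * Vᴴ) ((split j).symm (s, z)) ((split j).symm (s, w)) *
        star ((U * Vᴴ) ((split j).symm (t, z)) ((split j).symm (t, w))) := by
  have h : U * Vᴴ * mixedExtension j (Matrix.single s t 1) * V * Uᴴ =
      U * Vᴴ * mixedExtension j (Matrix.single s t 1) * (U * Vᴴ)ᴴ := by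
    rw [Matrix.conjTranspose_mul, Matrix.conjTranspose_conjTranspose, ← mul_assoc]
  change ∑ z, (U * Vᴴ * mixedExtension j (Matrix.single s t 1) * V * Uᴴ)
    ((split j).symm (s, z)) ((split j).symm (t, z)) = _
  rw [h, Finset.mul_sum]
  refine Finset.sum_congr rfl fun z _ => ?_
  rw [Matrix.mul_apply, sum_qubits_split j, Finset.mul_sum]
  refine Finset.sum_congr rfl fun w _ => ?_
  simp only [Matrix.mul_apply (M := U * Vᴴ), sum_qubits_split j, mixedExtension_split,
    Matrix.conjTranspose_apply, Matrix.single_apply]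
  simp [mul_ite, ite_and]
  ring

/-- Summing over s and t completes the square |∑ₛ W (s, z) (s, w)|² of `norm_siteProj_sq`; the
constants agree since ¼ · 2^{-(n-1)} = ½ · 2^{-n}. -/
theorem entanglementFidelity_eq (hn : 1 ≤ n) (U V : Matrix (Qubits n) (Qubits n) ℂ) (j : Fin n) :
    entanglementFidelity U V j = ‖siteProj j (U * Vᴴ)‖ ^ 2 / 2 ^ n := by
  have h : (bellProj * tensorId (localChannel U V j) bellProj).trace =
      ((‖siteProj j (U * Vᴴ)‖ ^ 2 / 2 ^ n : ℝ) : ℂ) := by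
    obtain ⟨m, rfl⟩ : ∃ m, n = m + 1 := ⟨n - 1, by omega⟩
    rw [trace_bellProj_mul_tensorId, norm_siteProj_sq]
    simp only [localChannel_single, Fin.sum_univ_two]
    push_cast
    simp only [← Complex.mul_conj', Finset.mul_sum, Finset.sum_div, ← Finset.sum_add_distrib,
      map_add, Complex.star_def]
    refine Finset.sum_congr rfl fun z _ => Finset.sum_congr rfl fun w _ => ?_
    generalize (U * Vᴴ) ((split j).symm (0, z)) ((split j).symm (0, w)) = p
    generalize (U * Vᴴ) ((split j).symm (1, z)) ((split j).symm (1, w)) = q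
    rw [pow_succ]
    field_simp
    ring
  rw [entanglementFidelity, h, Complex.ofReal_re]

/-- The global cost is bounded by `n` times the local cost. -/
theorem costHST_le (hn : 1 ≤ n) {U V : Matrix (Qubits n) (Qubits n) ℂ}
    (hU : U ∈ Matrix.unitaryGroup (Qubits n) ℂ) (hV : V ∈ Matrix.unitaryGroup (Qubits n) ℂ) :
    costHST U V ≤ n * costLHST U V := by
  have hn' : (n : ℝ) ≠ 0 := by positivity
  have hW : ‖U * Vᴴ‖ ^ 2 = (2 : ℝ) ^ n := by
    rw [← Matrix.star_eq_conjTranspose,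
      Matrix.frobenius_norm_sq_of_mem_unitaryGroup (mul_mem hU (Unitary.star_mem hV))]
    simp
  have h := norm_sq_sub_norm_trace_sq_le (U * Vᴴ)
  have h2 : (0 : ℝ) < 2 ^ n := by positivity
  rw [hW] at h
  have hL : n * costLHST U V = (∑ j, ((2 : ℝ) ^ n - ‖siteProj j (U * Vᴴ)‖ ^ 2)) / 2 ^ n := by
    simp only [costLHST, entanglementFidelity_eq hn, Finset.sum_sub_distrib, ← Finset.sum_div,
      Finset.sum_const, Finset.card_univ, Fintype.card_fin, nsmul_eq_mul]
    field_simp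
  rw [hL, costHST, le_div_iff₀ h2]
  refine le_trans (le_of_eq ?_) h
  field_simp

end VFF

/-! ### Chords and angles -/

theorem norm_exp_mul_I_sub_exp_mul_I_sq (a b : ℝ) :
    ‖Complex.exp (a * Complex.I) - Complex.exp (b * Complex.I)‖ ^ 2 = 2 * (1 - Real.cos (a - b)) := by
  rw [← Complex.normSq_eq_norm_sq, Complex.normSq_apply, Complex.sub_re, Complex.sub_im,
    Complex.exp_ofReal_mul_I_re, Complex.exp_ofReal_mul_I_re, Complex.exp_ofReal_mul_I_im,
    Complex.exp_ofReal_mul_I_im, Real.cos_sub]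
  linear_combination Real.sin_sq_add_cos_sq a + Real.sin_sq_add_cos_sq b

/-- An angle whose cosine is close to `1` is close to a multiple of `2π`. -/
theorem exists_int_abs_sub_lt_of_one_sub_cos_lt {θ ε : ℝ} (hε : 0 < ε)
    (h : 2 * (1 - Real.cos θ) < 4 / Real.pi ^ 2 * ε ^ 2) :
    ∃ k : ℤ, |θ - 2 * Real.pi * k| < ε := by
  -- This shift moves θ into (-π, π], where cos x ≤ 1 - 2x²/π²; hence the constant 4/π².
  refine ⟨toIocDiv Real.two_pi_pos (-Real.pi) θ, ?_⟩
  set k := toIocDiv Real.two_pi_pos (-Real.pi) θ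
  have hmem := sub_toIocDiv_zsmul_mem_Ioc Real.two_pi_pos (-Real.pi) θ
  rw [zsmul_eq_mul, mul_comm (toIocDiv _ _ _ : ℝ)] at hmem
  have habs : |θ - 2 * Real.pi * k| ≤ Real.pi := abs_le.2 ⟨hmem.1.le, by linarith [hmem.2]⟩
  have hcos := Real.cos_le_one_sub_mul_cos_sq habs
  rw [mul_comm (2 * Real.pi), Real.cos_sub_int_mul_two_pi, mul_comm _ (2 * Real.pi)] at hcos
  have hpi : 0 < 4 / Real.pi ^ 2 := by positivity
  have hsq : 4 / Real.pi ^ 2 * (θ - 2 * Real.pi * k) ^ 2 < 4 / Real.pi ^ 2 * ε ^ 2 := by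
    refine lt_of_le_of_lt ?_ h
    have : 4 / Real.pi ^ 2 * (θ - 2 * Real.pi * k) ^ 2 =
      2 * (2 / Real.pi ^ 2 * (θ - 2 * Real.pi * k) ^ 2) := by ring
    linarith
  exact abs_lt_of_sq_lt_sq (lt_of_mul_lt_mul_left hsq hpi.le) hε.le

/-! ### Optimal global phase and bounds on the discrepancy -/

namespace VFF

variable {n : ℕ} {U V : Matrix (Qubits n) (Qubits n) ℂ}

theorem norm_sub_exp_smul_sq (hU : U ∈ Matrix.unitaryGroup (Qubits n) ℂ)
    (hV : V ∈ Matrix.unitaryGroup (Qubits n) ℂ) (φ : ℝ) :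
    ‖U - Complex.exp ((φ : ℂ) * Complex.I) • V‖ ^ 2 =
      2 * 2 ^ n - 2 * (Complex.exp ((-φ : ℝ) * Complex.I) * (U * Vᴴ).trace).re := by
  rw [Matrix.frobenius_norm_sub_smul_sq hU hV (Complex.norm_exp_ofReal_mul_I φ),
    ← Complex.exp_conj]
  simp

theorem le_norm_sub_exp_smul_sq (hU : U ∈ Matrix.unitaryGroup (Qubits n) ℂ)
    (hV : V ∈ Matrix.unitaryGroup (Qubits n) ℂ) (φ : ℝ) :
    2 * 2 ^ n - 2 * ‖(U * Vᴴ).trace‖ ≤ ‖U - Complex.exp ((φ : ℂ) * Complex.I) • V‖ ^ 2 := by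
  rw [norm_sub_exp_smul_sq hU hV]
  have := Complex.re_le_norm (Complex.exp ((-φ : ℝ) * Complex.I) * (U * Vᴴ).trace)
  rw [norm_mul, Complex.norm_exp_ofReal_mul_I, one_mul] at this
  linarith

theorem norm_sub_exp_arg_smul_sq (hU : U ∈ Matrix.unitaryGroup (Qubits n) ℂ)
    (hV : V ∈ Matrix.unitaryGroup (Qubits n) ℂ) :
    ‖U - Complex.exp (((U * Vᴴ).trace.arg : ℂ) * Complex.I) • V‖ ^ 2 =
      2 * 2 ^ n - 2 * ‖(U * Vᴴ).trace‖ := by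
  rw [norm_sub_exp_smul_sq hU hV]
  have h : Complex.exp ((-(U * Vᴴ).trace.arg : ℝ) * Complex.I) * (U * Vᴴ).trace =
      ‖(U * Vᴴ).trace‖ := by
    nth_rewrite 2 [← Complex.norm_mul_exp_arg_mul_I (U * Vᴴ).trace]
    rw [mul_left_comm, ← Complex.exp_add, Complex.ofReal_neg, neg_mul, neg_add_cancel,
      Complex.exp_zero, mul_one]
  rw [h, Complex.ofReal_re]

/-- The argument of the trace rotates it onto the positive real axis, attaining Re = modulus. If the
trace vanishes, every phase is optimal. -/
theorem isOptimalPhase_arg (hU : U ∈ Matrix.unitaryGroup (Qubits n) ℂ)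
    (hV : V ∈ Matrix.unitaryGroup (Qubits n) ℂ) : IsOptimalPhase U V (U * Vᴴ).trace.arg := by
  intro ψ
  refine (sq_le_sq₀ (norm_nonneg _) (norm_nonneg _)).1 ?_
  rw [norm_sub_exp_arg_smul_sq hU hV]
  exact le_norm_sub_exp_smul_sq hU hV ψ

theorem IsOptimalPhase.norm_sq_eq {φ : ℝ} (hφ : IsOptimalPhase U V φ)
    (hU : U ∈ Matrix.unitaryGroup (Qubits n) ℂ) (hV : V ∈ Matrix.unitaryGroup (Qubits n) ℂ) :
    ‖U - Complex.exp ((φ : ℂ) * Complex.I) • V‖ ^ 2 =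
      2 * (2 : ℝ) ^ n * (1 - √(1 - costHST U V)) := by
  have h : √(1 - costHST U V) = ‖(U * Vᴴ).trace‖ / 2 ^ n := by
    rw [costHST, sub_sub_cancel, one_div, inv_mul_eq_div, ← div_pow, Real.sqrt_sq (by positivity)]
  have h' : 2 * (2 : ℝ) ^ n * (1 - √(1 - costHST U V)) = 2 * 2 ^ n - 2 * ‖(U * Vᴴ).trace‖ := by
    rw [h]
    field_simp
  rw [h']
  refine le_antisymm ?_ (le_norm_sub_exp_smul_sq hU hV φ)
  rw [← norm_sub_exp_arg_smul_sq hU hV]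
  exact pow_le_pow_left₀ (norm_nonneg _) (hφ _) 2

theorem exists_perm_discrepancy_le (hU : U ∈ Matrix.unitaryGroup (Qubits n) ℂ)
    (hV : V ∈ Matrix.unitaryGroup (Qubits n) ℂ) {lamExact lam : Fin (2 ^ n) → ℝ}
    (hE : IsEnergies U lamExact) (hL : IsEnergies V lam) (φ : ℝ) :
    ∃ σ : Equiv.Perm (Fin (2 ^ n)), discrepancy lamExact lam σ φ ≤
      ‖U - Complex.exp ((φ : ℂ) * Complex.I) • V‖ ^ 2 := by
  obtain ⟨σ, hσ⟩ := Matrix.exists_perm_sum_norm_sub_sq_le_of_roots hU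
    (Matrix.smul_mem_unitaryGroup hV (Complex.norm_exp_ofReal_mul_I φ)) hE
    (Matrix.roots_charpoly_smul_of_mem_unitaryGroup hV hL _)
  refine ⟨σ, le_trans (le_of_eq (Finset.sum_congr rfl fun i _ => ?_)) hσ⟩
  have h := norm_exp_mul_I_sub_exp_mul_I_sq (-lamExact i) (φ - lam (σ i))
  rw [← Real.cos_neg, show -(-lamExact i - (φ - lam (σ i))) = lamExact i - lam (σ i) + φ by ring] at h
  rw [← h, ← Complex.exp_add]
  push_cast
  ring_nf

theorem discrepancy_nonneg {d : ℕ} (lamExact lam : Fin d → ℝ) (σ : Equiv.Perm (Fin d)) (φ : ℝ) :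
    0 ≤ discrepancy lamExact lam σ φ :=
  Finset.sum_nonneg fun i _ => by linarith [Real.cos_le_one (lamExact i - lam (σ i) + φ)]

theorem term_le_discrepancy {d : ℕ} (lamExact lam : Fin d → ℝ) (σ : Equiv.Perm (Fin d)) (φ : ℝ)
    (i : Fin d) : 2 * (1 - Real.cos (lamExact i - lam (σ i) + φ)) ≤
      discrepancy lamExact lam σ φ :=
  Finset.single_le_sum (f := fun i => 2 * (1 - Real.cos (lamExact i - lam (σ i) + φ)))
    (fun i _ => by linarith [Real.cos_le_one (lamExact i - lam (σ i) + φ)]) (Finset.mem_univ i)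

/-- No condition n C_LHST ≤ 1 is needed: `√` is monotone on all of ℝ, being 0 at negative arguments.
-/
theorem IsOptimalPhase.norm_sq_le {φ : ℝ} (hφ : IsOptimalPhase U V φ) (hn : 1 ≤ n)
    (hU : U ∈ Matrix.unitaryGroup (Qubits n) ℂ) (hV : V ∈ Matrix.unitaryGroup (Qubits n) ℂ) :
    ‖U - Complex.exp ((φ : ℂ) * Complex.I) • V‖ ^ 2 ≤ costBound U V := by
  rw [hφ.norm_sq_eq hU hV, costBound]
  gcongr
  exact costHST_le hn hU hV

theorem costBound_le (h₁ : n * costLHST U V ≤ 1) (h₀ : 0 ≤ n * costLHST U V) :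
    costBound U V ≤ 2 * 2 ^ n * (n * costLHST U V) := by
  rw [costBound]
  gcongr
  have : 1 - n * costLHST U V ≤ √(1 - n * costLHST U V) := by
    refine Real.le_sqrt_of_sq_le ?_
    nlinarith
  linarith

/-- Nonnegativity of the minimal squared distance 2d - 2|Tr UV†| gives |Tr UV†| ≤ d. -/
theorem costHST_nonneg (hU : U ∈ Matrix.unitaryGroup (Qubits n) ℂ)
    (hV : V ∈ Matrix.unitaryGroup (Qubits n) ℂ) : 0 ≤ costHST U V := by
  have h := (sq_nonneg _).trans_eq (norm_sub_exp_arg_smul_sq hU hV)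
  have h2 : (0 : ℝ) < 2 ^ n := by positivity
  rw [costHST, sub_nonneg, one_div, inv_mul_eq_div, ← div_pow]
  refine pow_le_one₀ (by positivity) ((div_le_one h2).2 ?_)
  linarith

end VFF

/-! ### Assembly of the theorem -/

theorem mainTheorem5 (n : ℕ) (hn : 1 ≤ n) :
    (∀ U ∈ Matrix.unitaryGroup (VFF.Qubits n) ℂ, ∀ V ∈ Matrix.unitaryGroup (VFF.Qubits n) ℂ,
      ∀ lamExact lam : Fin (2 ^ n) → ℝ, VFF.IsEnergies U lamExact → VFF.IsEnergies V lam →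
        (∃ σ : Equiv.Perm (Fin (2 ^ n)),
          ∑ i, ‖Complex.exp (Complex.I * (lamExact i : ℂ)) -
              Complex.exp (Complex.I * (lam (σ i) : ℂ))‖ ^ 2 ≤ ‖U - V‖ ^ 2) ∧
        (∃ φ₀ : ℝ, VFF.IsOptimalPhase U V φ₀) ∧
        ∀ φ₀ : ℝ, VFF.IsOptimalPhase U V φ₀ →
          ‖U - Complex.exp ((φ₀ : ℂ) * Complex.I) • V‖ =
              √(2 * (2 : ℝ) ^ n * (1 - √(1 - VFF.costHST U V))) ∧
          ∃ σ : Equiv.Perm (Fin (2 ^ n)),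
            VFF.discrepancy lamExact lam σ φ₀ ≤
                ‖U - Complex.exp ((φ₀ : ℂ) * Complex.I) • V‖ ^ 2 ∧
            ((n : ℝ) * VFF.costLHST U V ≤ 1 →
              VFF.discrepancy lamExact lam σ φ₀ ≤ VFF.costBound U V ∧
              (VFF.costBound U V ≤ 1 →
                VFF.discrepancy lamExact lam σ φ₀ ≤ √(VFF.costBound U V)))) ∧
    (∀ ε : ℝ, 0 < ε → ∃ δ : ℝ, 0 < δ ∧
      ∀ U ∈ Matrix.unitaryGroup (VFF.Qubits n) ℂ, ∀ V ∈ Matrix.unitaryGroup (VFF.Qubits n) ℂ,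
      ∀ lamExact lam : Fin (2 ^ n) → ℝ, VFF.IsEnergies U lamExact → VFF.IsEnergies V lam →
        VFF.costLHST U V < δ →
        ∀ φ₀ : ℝ, VFF.IsOptimalPhase U V φ₀ →
          ∃ σ : Equiv.Perm (Fin (2 ^ n)),
            VFF.discrepancy lamExact lam σ φ₀ ≤ VFF.costBound U V ∧
            VFF.discrepancy lamExact lam σ φ₀ < ε ∧
            ∀ i, ∃ k : ℤ, |lamExact i - lam (σ i) + φ₀ - 2 * Real.pi * k| < ε) := by
  refine ⟨fun U hU V hV lamExact lam hE hL => ⟨?_, ⟨_, VFF.isOptimalPhase_arg hU hV⟩,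
    fun φ₀ hφ => ⟨?_, ?_⟩⟩, fun ε hε => ?_⟩
  -- Phase 0 suffices. The sign change from e^{-iλ} to e^{iλ} is harmless, as both chords have
  -- squared length 2(1 - cos).
  · obtain ⟨σ, hσ⟩ := VFF.exists_perm_discrepancy_le hU hV hE hL 0
    refine ⟨σ, le_trans (le_of_eq (Finset.sum_congr rfl fun i _ => ?_)) (hσ.trans_eq (by simp))⟩
    rw [mul_comm Complex.I, mul_comm Complex.I, norm_exp_mul_I_sub_exp_mul_I_sq, add_zero]
  · rw [← hφ.norm_sq_eq hU hV, Real.sqrt_sq (norm_nonneg _)]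
  · obtain ⟨σ, hσ⟩ := VFF.exists_perm_discrepancy_le hU hV hE hL φ₀
    have hB := hσ.trans (hφ.norm_sq_le hn hU hV)
    have hB0 := (VFF.discrepancy_nonneg lamExact lam σ φ₀).trans hB
    refine ⟨σ, hσ, fun _ => ⟨hB, fun hB1 => hB.trans (Real.le_sqrt_of_sq_le ?_)⟩⟩
    exact pow_le_of_le_one hB0 hB1 two_ne_zero
  · have hn0 : (0 : ℝ) < n := by exact_mod_cast hn
    set η : ℝ := min ε (4 / Real.pi ^ 2 * ε ^ 2)
    have hη : 0 < η := lt_min hε (by positivity)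
    -- The first term ensures n C_LHST ≤ 1, the second that the linearized bound 2d · n C_LHST is
    -- below `η`.
    refine ⟨min (1 / n) (η / (2 * 2 ^ n * n)), by positivity,
      fun U hU V hV lamExact lam hE hL hC φ₀ hφ => ?_⟩
    obtain ⟨σ, hσ⟩ := VFF.exists_perm_discrepancy_le hU hV hE hL φ₀
    have hB := hσ.trans (hφ.norm_sq_le hn hU hV)
    have h₁ : n * VFF.costLHST U V ≤ 1 := by
      have := (lt_div_iff₀' hn0).1 (hC.trans_le (min_le_left _ _))
      exact this.le
    have h₂ : 2 * 2 ^ n * (n * VFF.costLHST U V) < η := by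
      have := (lt_div_iff₀' (by positivity)).1 (hC.trans_le (min_le_right _ _))
      rwa [mul_assoc] at this
    have hlt := (hB.trans (VFF.costBound_le h₁
      ((VFF.costHST_nonneg hU hV).trans (VFF.costHST_le hn hU hV)))).trans_lt h₂
    exact ⟨σ, hB, hlt.trans_le (min_le_left _ _), fun i =>
      exists_int_abs_sub_lt_of_one_sub_cos_lt hε (((VFF.term_le_discrepancy _ _ σ φ₀ i).trans_lt
        hlt).trans_le (min_le_right _ _))⟩
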